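/- Let $\delta\in\{\mathrm{HD},\mathrm{FD}\}$ (half or full duplex), and put $\mathbb 1_\delta=0,\ \kappa=1$ if $\delta=\mathrm{HD}$ and $\mathbb 1_\delta=1,\ \kappa=2$ if $\delta=\mathrm{FD}$. Let $\lambda>0$, $\mu,\mathcal P_\delta,\beta\in[0,1]$, $\alpha>2$, $\sigma^2\ge 0$, $\rho_d>0$, $\mathcal R_d>0$, and assume $\sigma^2+\mathbb 1_\delta\beta\rho_d>0$ or $\mu\mathcal P_\delta\lambda>0$. Let $\Phi_\delta=\{z_i\}$ be a homogeneous Poisson point process on $\mathbb R^2$ of intensity $\mu\mathcal P_\delta\lambda$, let $h$ and the $h_i$ be exponentially distributed with unit mean, all jointly independent and independent of $\Phi_\delta$, and let $z_o\in\mathbb R^2$ with $\|z_o\|=\mathcal R_d$ be the transmitter of the typical receiver, which is located at the origin. Define the interference, the SINR and the per-link spectral efficiency by $$\mathcal I_{d,\delta}=\sum_{z_i\in\Phi_\delta\setminus\{z_o\}}\rho_d h_i\|z_i\|^{-\alpha},\qquad \Upsilon^\delta=\frac{\rho_d h\mathcal R_d^{-\alpha}}{\sigma^2+\mathcal I_{d,\delta}+\mathbb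 1_\delta\beta\rho_d},\qquad \mathcal S_\delta=\kappa\,\mathbb E[\log_2(1+\Upsilon^\delta)],$$ and let $\mathcal L_{\mathcal I_{d,\delta}}(s)=\mathbb E[e^{-s\mathcal I_{d,\delta}}]$. Then, almost surely, the sum defining $\mathcal I_{d,\delta}$ converges and the denominator of $\Upsilon^\delta$ is positive; the expectation $\mathcal S_\delta$ and the integral below are finite; and $$\mathcal S_\delta=\frac{\kappa}{\ln 2}\int_0^\infty\frac{e^{-(\sigma^2+\mathbb 1_\delta\beta\rho_d)\mathcal R_d^\alpha\tau/\rho_d}}{1+\tau}\,\mathcal L_{\mathcal I_{d,\delta}}\!\left(\frac{\tau\mathcal R_d^\alpha}{\rho_d}\right)d\tau .$$ -/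

import Mathlib

open MeasureTheory ProbabilityTheory

noncomputable section

/-- The Euclidean plane, in which the devices are located. -/
abbrev Plane : Type := EuclideanSpace ℝ (Fin 2)

/-- The operation mode of a D2D link: half duplex or full duplex. -/
inductive D2DMode
  | HD
  | FD

/-- The indicator of full-duplex operation. -/
def D2DMode.indFD : D2DMode → ℝ
  | .HD => 0
  | .FD => 1

/-- The number of simultaneous links of a D2D pair. -/
def D2DMode.kappa : D2DMode → ℝ
  | .HD => 1
  | .FD => 2

section PointProcess

variable {Ω E : Type*}

/-- A point process is given by its (possibly infinite) total number of points `N` and an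
enumeration `z` of them: in state `ω` its points are `z i ω` for the indices `i < N ω` (the other
values of `z` are irrelevant). This is the number of its points in `B`. -/
def pointCount (N : Ω → ℕ∞) (z : ℕ → Ω → E) (B : Set E) (ω : Ω) : ℕ∞ :=
  Set.encard {i : ℕ | (i : ℕ∞) < N ω ∧ z i ω ∈ B}

/-- The point process `(N, z)` is a Poisson point process with intensity measure `ν`: the numbers
of points in sets of finite intensity are Poisson distributed, and the numbers of points in
disjoint sets are independent. -/
structure IsPoissonPointProcess [MeasurableSpace Ω] [MeasurableSpace E] (P : Measure Ω)
    (ν : Measure E) (N : Ω → ℕ∞) (z : ℕ → Ω → E) : Prop where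
  measurable_total : Measurable N
  measurable_point : ∀ i, Measurable (z i)
  poisson_count : ∀ B : Set E, MeasurableSet B → ν B < ⊤ → ∀ k : ℕ,
    P {ω | pointCount N z B ω = k} =
      ENNReal.ofReal (Real.exp (-(ν B).toReal) * (ν B).toReal ^ k / (Nat.factorial k : ℝ))
  indep_count : ∀ (n : ℕ) (B : Fin n → Set E), (∀ j, MeasurableSet (B j)) → (∀ j, ν (B j) < ⊤) →
    Pairwise (fun j k => Disjoint (B j) (B k)) →
    iIndepFun (fun j => pointCount N z (B j)) P

end PointProcess

section Network

variable {Ω : Type*}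

/-- The random environment of the typical receiver, located at the origin: the transmitters form a
homogeneous Poisson point process `(N, z)` with `intensity` points per unit area; the fading gain
`h` of the desired link and the fading gains `g i` of the links from the points `z i` to the
receiver are exponentially distributed with unit mean (Rayleigh fading); all the gains and the
point process are jointly independent. -/
structure IsD2DNetwork [MeasurableSpace Ω] (P : Measure Ω) (intensity : ℝ)
    (N : Ω → ℕ∞) (z : ℕ → Ω → Plane) (h : Ω → ℝ) (g : ℕ → Ω → ℝ) : Prop where
  poisson : IsPoissonPointProcess P (ENNReal.ofReal intensity • (volume : Measure Plane)) N z
  measurable_h : Measurable h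
  measurable_g : ∀ i, Measurable (g i)
  law_h : P.map h = expMeasure 1
  law_g : ∀ i, P.map (g i) = expMeasure 1
  indep_g : iIndepFun g P
  indep_points_g : IndepFun (fun ω => (N ω, fun i => z i ω)) (fun ω i => g i ω) P
  indep_h : IndepFun h (fun ω => ((N ω, fun i => z i ω), fun i => g i ω)) P

open Classical in
/-- The power received at the origin from the `i`-th point of the process, if there is such a point
and it is not the desired transmitter `zo`; otherwise `0`. Here `ρ` is the transmit power and `α`
is the path-loss exponent. -/
def interferenceTerm (ρ α : ℝ) (zo : Plane) (N : Ω → ℕ∞) (z : ℕ → Ω → Plane) (g : ℕ → Ω → ℝ)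
    (i : ℕ) (ω : Ω) : ℝ :=
  if (i : ℕ∞) < N ω ∧ z i ω ≠ zo then ρ * g i ω * ‖z i ω‖ ^ (-α) else 0

/-- The total interference at the origin. -/
def interference (ρ α : ℝ) (zo : Plane) (N : Ω → ℕ∞) (z : ℕ → Ω → Plane) (g : ℕ → Ω → ℝ)
    (ω : Ω) : ℝ :=
  ∑' i, interferenceTerm ρ α zo N z g i ω

/-- Noise plus interference plus residual self-interference; `σ2` is the noise power and `β` is the
residual self-interference-to-power ratio. -/
def sinrDenom (δ : D2DMode) (σ2 β ρ α : ℝ) (zo : Plane) (N : Ω → ℕ∞) (z : ℕ → Ω → Plane)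
    (g : ℕ → Ω → ℝ) (ω : Ω) : ℝ :=
  σ2 + interference ρ α zo N z g ω + δ.indFD * (β * ρ)

/-- The SINR at the typical receiver, whose desired transmitter `zo` is at distance `‖zo‖`. -/
def sinr (δ : D2DMode) (σ2 β ρ α : ℝ) (zo : Plane) (N : Ω → ℕ∞) (z : ℕ → Ω → Plane) (h : Ω → ℝ)
    (g : ℕ → Ω → ℝ) (ω : Ω) : ℝ :=
  ρ * h ω * ‖zo‖ ^ (-α) / sinrDenom δ σ2 β ρ α zo N z g ω

/-- The Laplace transform of a random variable. -/
def laplaceTransform [MeasurableSpace Ω] (P : Measure Ω) (X : Ω → ℝ) (s : ℝ) : ℝ :=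
  ∫ ω, Real.exp (-s * X ω) ∂P

/-- The spectral efficiency of a D2D link in mode `δ`. -/
def spectralEfficiency [MeasurableSpace Ω] (P : Measure Ω) (δ : D2DMode) (σ2 β ρ α : ℝ)
    (zo : Plane) (N : Ω → ℕ∞) (z : ℕ → Ω → Plane) (h : Ω → ℝ) (g : ℕ → Ω → ℝ) : ℝ :=
  δ.kappa * ∫ ω, Real.logb 2 (1 + sinr δ σ2 β ρ α zo N z h g ω) ∂P

/-- The integrand of the spectral efficiency formula, where `R` is the distance from the receiver to
its transmitter and `L` is the Laplace transform of the interference. -/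
def seIntegrand (δ : D2DMode) (σ2 β ρ α R : ℝ) (L : ℝ → ℝ) (τ : ℝ) : ℝ :=
  Real.exp (-(σ2 + δ.indFD * (β * ρ)) * R ^ α / ρ * τ) / (1 + τ) * L (τ * R ^ α / ρ)

end Network

end

/-! ### Exponential law with unit mean: tail, mean and Laplace transform. -/

section ExponentialLaw

variable {Ω : Type*} [MeasurableSpace Ω] {P : Measure Ω} {X : Ω → ℝ}

/-! Write `n` for noise plus residual self-interference and `I` for the interference. Since log(1 +
x) is the integral of 1/(1 + t) over [0, x], the layer-cake formula turns E[log(1 + SINR)] into the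
integral of P(SINR > t)/(1 + t). With k = t R^α / ρ, the event SINR > t says that the fading gain
exceeds k(n + I); the gain is exponential and independent of `I`, so the probability is exp(-kn)
times the Laplace transform of `I` at k. This is the stated integrand (`measure_lt_sinr`,
`lintegral_log_one_add_sinr`). The identity is proved for extended nonnegative integrals, so
finiteness can be settled afterwards on either side.

The analytic content lies in three almost sure or integrability claims. The interference converges
because finitely many points lie in the unit ball, and the expected path loss of the others is
finite by Campbell's formula and α > 2.

Positivity of the denominator and finiteness of the integral are immediate if n > 0. If n = 0, both
rest on a decay estimate for the Laplace transform (`lintegral_exp_neg_interference_le`): either a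
ball of radius r contains no usable point, which has probability exp(-cπr²), or its first point
alone contributes at least ρ r^(-α) times an exponential gain. A suitable r for each s makes the
bound tend to 0, excluding `I` = 0, and makes it polynomially small in s, which compensates for the
divergence of the integral of 1/(1 + t). -/

lemma expMeasure_one_Ioi {x : ℝ} (hx : 0 ≤ x) :
    expMeasure 1 (Set.Ioi x) = ENNReal.ofReal (Real.exp (-x)) := by
  have := isProbabilityMeasure_expMeasure (r := 1) one_pos
  rw [← Set.compl_Iic, prob_compl_eq_one_sub measurableSet_Iic, ← ofReal_cdf,
    cdf_expMeasure_eq one_pos, if_pos hx, ← ENNReal.ofReal_one,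
    ← ENNReal.ofReal_sub _ (by simpa using hx)]
  simp

lemma ae_pos_of_law_exp (hX : Measurable X) (hlaw : P.map X = expMeasure 1) :
    ∀ᵐ ω ∂P, 0 < X ω := by
  have := isProbabilityMeasure_expMeasure (r := 1) one_pos
  have h : ∀ᵐ x ∂P.map X, 0 < x := by
    rw [hlaw]
    have h1 : expMeasure 1 (Set.Ioi 0) = 1 := by simp [expMeasure_one_Ioi le_rfl]
    exact (prob_compl_eq_zero_iff measurableSet_Ioi).2 h1
  exact ae_of_ae_map hX.aemeasurable h

lemma lintegral_ofReal_of_law_exp (hX : Measurable X) (hlaw : P.map X = expMeasure 1) :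
    ∫⁻ ω, ENNReal.ofReal (X ω) ∂P = 1 := by
  rw [lintegral_eq_lintegral_meas_lt P
    ((ae_pos_of_law_exp hX hlaw).mono fun _ h => h.le) hX.aemeasurable]
  have h : ∀ t ∈ Set.Ioi (0 : ℝ), P {ω | t < X ω} = ENNReal.ofReal (Real.exp (-t)) := by
    intro t ht
    rw [← expMeasure_one_Ioi (le_of_lt ht), ← hlaw, Measure.map_apply hX measurableSet_Ioi]
    rfl
  rw [setLIntegral_congr_fun measurableSet_Ioi h,
    ← ofReal_integral_eq_lintegral_ofReal (integrableOn_exp_neg_Ioi 0)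
      (Filter.Eventually.of_forall fun _ => (Real.exp_pos _).le), integral_exp_neg_Ioi_zero]
  simp

/-- The density is at most 1 on the half-line. The exact value is 1/(1 + s), but only decay in s
matters. -/
lemma lintegral_exp_neg_mul_le_of_law_exp (hX : Measurable X) (hlaw : P.map X = expMeasure 1)
    {s : ℝ} (hs : 0 < s) :
    ∫⁻ ω, ENNReal.ofReal (Real.exp (-s * X ω)) ∂P ≤ ENNReal.ofReal (1 / s) := by
  have hm : Measurable fun x : ℝ => ENNReal.ofReal (Real.exp (-s * x)) := by fun_prop
  have hpdf : Measurable (exponentialPDF 1) := by unfold exponentialPDF; fun_prop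
  have hdens : expMeasure 1 = volume.withDensity (exponentialPDF 1) := rfl
  rw [← lintegral_map hm hX, hlaw, hdens, lintegral_withDensity_eq_lintegral_mul _ hpdf hm]
  calc ∫⁻ x, (exponentialPDF 1 * fun x => ENNReal.ofReal (Real.exp (-s * x))) x
      ≤ ∫⁻ x, (Set.Ici (0 : ℝ)).indicator (fun x => ENNReal.ofReal (Real.exp (-s * x))) x := by
        refine lintegral_mono fun x => ?_
        by_cases hx : 0 ≤ x
        · have h1 : exponentialPDF 1 x ≤ 1 := by
            rw [exponentialPDF_of_nonneg hx]
            simpa using hx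
          simpa [Set.indicator_of_mem (Set.mem_Ici.2 hx)] using
            mul_le_of_le_one_left (zero_le (a := ENNReal.ofReal (Real.exp (-s * x)))) h1
        · simp [exponentialPDF_of_neg (not_le.1 hx)]
    _ = ENNReal.ofReal (1 / s) := by
        rw [lintegral_indicator measurableSet_Ici, setLIntegral_congr Ioi_ae_eq_Ici.symm,
          ← ofReal_integral_eq_lintegral_ofReal (integrableOn_exp_mul_Ioi (by linarith) 0)
            (Filter.Eventually.of_forall fun _ => (Real.exp_pos _).le),
          integral_exp_mul_Ioi (by linarith)]
        simp

end ExponentialLaw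

/-! ### Poisson point processes: mean measure, Campbell's formula, void probabilities. -/

section PointProcess

lemma coe_pointCount {Ω E : Type*} (N : Ω → ℕ∞) (z : ℕ → Ω → E) (B : Set E) (ω : Ω) :
    (pointCount N z B ω : ENNReal) =
      ∑' i : ℕ, {ω | (i : ℕ∞) < N ω ∧ z i ω ∈ B}.indicator (fun _ => (1 : ENNReal)) ω := by
  rw [pointCount, ← ENNReal.tsum_set_one, tsum_subtype _ (fun _ => (1 : ENNReal))]
  rfl

variable {Ω E : Type*} [MeasurableSpace Ω] [MeasurableSpace E] {P : Measure Ω} {ν : Measure E}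
  {N : Ω → ℕ∞} {z : ℕ → Ω → E}

lemma measurableSet_point_mem (hN : Measurable N) (hz : ∀ i, Measurable (z i)) {B : Set E}
    (hB : MeasurableSet B) (i : ℕ) : MeasurableSet {ω | (i : ℕ∞) < N ω ∧ z i ω ∈ B} :=
  (hN (MeasurableSet.of_discrete (s := Set.Ioi (i : ℕ∞)))).inter (hz i hB)

lemma measurable_coe_pointCount (hN : Measurable N) (hz : ∀ i, Measurable (z i)) {B : Set E}
    (hB : MeasurableSet B) : Measurable fun ω => (pointCount N z B ω : ENNReal) := by
  simp_rw [coe_pointCount]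
  exact Measurable.tsum fun i =>
    measurable_const.indicator (measurableSet_point_mem hN hz hB i)

/-- The mean measure of a point process. -/
noncomputable def meanMeasure (P : Measure Ω) (N : Ω → ℕ∞) (z : ℕ → Ω → E) : Measure E :=
  Measure.sum fun i : ℕ => (P.restrict {ω | (i : ℕ∞) < N ω}).map (z i)

lemma meanMeasure_apply (hN : Measurable N) (hz : ∀ i, Measurable (z i)) {B : Set E}
    (hB : MeasurableSet B) :
    meanMeasure P N z B = ∫⁻ ω, (pointCount N z B ω : ENNReal) ∂P := by
  simp_rw [coe_pointCount]
  rw [lintegral_tsum fun i => (measurable_const.indicator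
    (measurableSet_point_mem hN hz hB i)).aemeasurable, meanMeasure, Measure.sum_apply _ hB]
  refine tsum_congr fun i => ?_
  rw [lintegral_indicator_const (measurableSet_point_mem hN hz hB i), one_mul,
    Measure.map_apply (hz i) hB, Measure.restrict_apply (hz i hB), Set.inter_comm]
  rfl

/-- The mean of a Poisson law: cancelling k against k! shifts the series by one and leaves r times
its total mass. -/
lemma tsum_mul_poisson (r : NNReal) :
    ∑' k : ℕ, (k : ENNReal) *
      ENNReal.ofReal (Real.exp (-(r : ℝ)) * (r : ℝ) ^ k / (Nat.factorial k : ℝ)) = r := by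
  rw [tsum_eq_zero_add' ENNReal.summable]
  have hstep : ∀ k : ℕ, ((k + 1 : ℕ) : ENNReal) *
      ENNReal.ofReal (Real.exp (-(r : ℝ)) * (r : ℝ) ^ (k + 1) / (Nat.factorial (k + 1) : ℝ)) =
      (r : ENNReal) *
        ENNReal.ofReal (Real.exp (-(r : ℝ)) * (r : ℝ) ^ k / (Nat.factorial k : ℝ)) := by
    intro k
    rw [← ENNReal.ofReal_natCast (k + 1), ← ENNReal.ofReal_mul (by positivity),
      ← ENNReal.ofReal_coe_nnreal, ← ENNReal.ofReal_mul (by positivity)]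
    congr 1
    rw [Nat.factorial_succ]
    push_cast
    field_simp
    ring
  have h1 := hasSum_one_poissonMeasure r
  simp_rw [hstep]
  rw [ENNReal.tsum_mul_left, ← ENNReal.ofReal_tsum_of_nonneg (fun k => by positivity) h1.summable,
    h1.tsum_eq]
  simp

namespace IsPoissonPointProcess

lemma lintegral_pointCount [IsProbabilityMeasure P] (hpp : IsPoissonPointProcess P ν N z)
    {B : Set E} (hB : MeasurableSet B) (hνB : ν B < ⊤) :
    ∫⁻ ω, (pointCount N z B ω : ENNReal) ∂P = ν B := by
  have hcount : Measurable (pointCount N z B) := by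
    have h := measurable_coe_pointCount hpp.measurable_total hpp.measurable_point hB
    refine measurable_to_countable' fun k => ?_
    have : pointCount N z B ⁻¹' {k} =
        (fun ω => (pointCount N z B ω : ENNReal)) ⁻¹' {(k : ENNReal)} := by
      ext ω
      simp
    rw [this]
    exact h (measurableSet_singleton _)
  have hk : ∀ k : ℕ, P.map (pointCount N z B) {(k : ℕ∞)} = ENNReal.ofReal
      (Real.exp (-(ν B).toReal) * (ν B).toReal ^ k / (Nat.factorial k : ℝ)) := fun k => by
    rw [Measure.map_apply hcount (measurableSet_singleton _)]
    exact hpp.poisson_count B hB hνB k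
  have hsum : ∑' k : ℕ, ENNReal.ofReal
      (Real.exp (-(ν B).toReal) * (ν B).toReal ^ k / (Nat.factorial k : ℝ)) = 1 := by
    have h1 := hasSum_one_poissonMeasure (ν B).toNNReal
    rw [← ENNReal.ofReal_one, ← h1.tsum_eq,
      ENNReal.ofReal_tsum_of_nonneg (fun k => by positivity) h1.summable]
    rfl
  -- The hypothesis prescribes only the probabilities of finite counts; they already sum to 1, so an
  -- infinite count has probability 0.
  have htop : P.map (pointCount N z B) {⊤} = 0 := by
    have : IsProbabilityMeasure (P.map (pointCount N z B)) :=
      Measure.isProbabilityMeasure_map hcount.aemeasurable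
    have hrange : P.map (pointCount N z B) (Set.range ((↑) : ℕ → ℕ∞)) = 1 := by
      rw [← hsum, ← Set.iUnion_singleton_eq_range,
        measure_iUnion (fun i j hij => by simpa using hij) fun _ => measurableSet_singleton _]
      exact tsum_congr hk
    have := (prob_compl_eq_zero_iff (μ := P.map (pointCount N z B))
      (MeasurableSet.of_discrete (s := Set.range ((↑) : ℕ → ℕ∞)))).2 hrange
    refine measure_mono_null ?_ this
    rintro x rfl ⟨n, hn⟩
    exact ENat.natCast_ne_top n hn
  have hmap := lintegral_map (μ := P) (f := fun k : ℕ∞ => (k : ENNReal))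
    (measurable_of_countable _) hcount
  rw [← hmap, lintegral_countable', 
    ← (Nat.cast_injective (R := ℕ∞)).tsum_eq]
  · conv_rhs => rw [← ENNReal.coe_toNNReal hνB.ne, ← tsum_mul_poisson]
    exact tsum_congr fun k => congrArg _ (hk k)
  · intro k hk'
    induction k using ENat.recTopCoe with
    | top => simp [htop] at hk'
    | coe n => exact ⟨n, rfl⟩

/-- The mean count is known only on sets of finite intensity; exhausting by spanning sets and
monotone continuity give the rest. -/
lemma meanMeasure_eq [IsProbabilityMeasure P] [SigmaFinite ν]
    (hpp : IsPoissonPointProcess P ν N z) : meanMeasure P N z = ν := by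
  ext B hB
  have hmono : Monotone fun n => B ∩ spanningSets ν n := fun _ _ h =>
    Set.inter_subset_inter_right _ (monotone_spanningSets ν h)
  have hU : B = ⋃ n, B ∩ spanningSets ν n := by
    rw [← Set.inter_iUnion, iUnion_spanningSets, Set.inter_univ]
  rw [hU, hmono.measure_iUnion, hmono.measure_iUnion]
  refine iSup_congr fun n => ?_
  have hBn := hB.inter (measurableSet_spanningSets ν n)
  rw [meanMeasure_apply hpp.measurable_total hpp.measurable_point hBn]
  exact hpp.lintegral_pointCount hBn
    ((measure_mono Set.inter_subset_right).trans_lt (measure_spanningSets_lt_top ν n))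

/-- Campbell's formula. -/
lemma tsum_lintegral_point [IsProbabilityMeasure P] [SigmaFinite ν]
    (hpp : IsPoissonPointProcess P ν N z) {f : E → ENNReal} (hf : Measurable f) :
    ∑' i : ℕ, ∫⁻ ω, {ω | (i : ℕ∞) < N ω}.indicator (fun ω => f (z i ω)) ω ∂P =
      ∫⁻ x, f x ∂ν := by
  conv_rhs => rw [← hpp.meanMeasure_eq, meanMeasure, lintegral_sum_measure]
  refine tsum_congr fun i => ?_
  have hm : MeasurableSet {ω | (i : ℕ∞) < N ω} :=
    hpp.measurable_total (MeasurableSet.of_discrete (s := Set.Ioi (i : ℕ∞)))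
  rw [lintegral_map hf (hpp.measurable_point i), lintegral_indicator hm]

lemma ae_finite_points [IsProbabilityMeasure P] (hpp : IsPoissonPointProcess P ν N z)
    {B : Set E} (hB : MeasurableSet B) (hνB : ν B < ⊤) :
    ∀ᵐ ω ∂P, {i : ℕ | (i : ℕ∞) < N ω ∧ z i ω ∈ B}.Finite := by
  have h := ae_lt_top
    (measurable_coe_pointCount hpp.measurable_total hpp.measurable_point hB)
    ((hpp.lintegral_pointCount hB hνB).trans_ne hνB.ne)
  filter_upwards [h] with ω hω
  rw [ENat.toENNReal_lt_top] at hω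
  exact Set.encard_lt_top_iff.1 hω

lemma measure_no_point_mem (hpp : IsPoissonPointProcess P ν N z)
    {B : Set E} (hB : MeasurableSet B) (hνB : ν B < ⊤) :
    P {ω | ∀ i : ℕ, (i : ℕ∞) < N ω → z i ω ∉ B} =
      ENNReal.ofReal (Real.exp (-(ν B).toReal)) := by
  have h := hpp.poisson_count B hB hνB 0
  simp only [pow_zero, mul_one, Nat.factorial_zero, Nat.cast_one, div_one] at h
  rw [← h]
  congr 1
  ext ω
  simp [pointCount, Set.eq_empty_iff_forall_notMem]

end IsPoissonPointProcess

end PointProcess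

/-! ### Almost sure convergence of the interference. -/

section Network

variable {Ω : Type*} [MeasurableSpace Ω] {P : Measure Ω} {c ρ α : ℝ} {zo : Plane}
  {N : Ω → ℕ∞} {z : ℕ → Ω → Plane} {h : Ω → ℝ} {g : ℕ → Ω → ℝ}

lemma measurable_interferenceTerm (hN : Measurable N) (hz : ∀ i, Measurable (z i))
    (hg : ∀ i, Measurable (g i)) (i : ℕ) : Measurable (interferenceTerm ρ α zo N z g i) := by
  have hs : MeasurableSet {ω | (i : ℕ∞) < N ω ∧ z i ω ≠ zo} :=
    measurableSet_point_mem hN hz (measurableSet_singleton zo).compl i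
  exact Measurable.ite hs
    (((hg i).const_mul ρ).mul ((hz i).norm.pow_const (-α))) measurable_const

lemma measurable_interference (hN : Measurable N) (hz : ∀ i, Measurable (z i))
    (hg : ∀ i, Measurable (g i)) : Measurable (interference ρ α zo N z g) :=
  Measurable.tsum fun i => measurable_interferenceTerm hN hz hg i

/-- The intensity measure of the transmitters has finite integral of the path loss away from the
receiver. -/
lemma lintegral_pathLoss_lt_top (hα : 2 < α) :
    ∫⁻ x, {x : Plane | 1 < ‖x‖}.indicator (fun x => ENNReal.ofReal (‖x‖ ^ (-α))) x
      ∂(ENNReal.ofReal c • (volume : Measure Plane)) < ⊤ := by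
  rw [lintegral_smul_measure]
  refine ENNReal.mul_lt_top ENNReal.ofReal_lt_top ?_
  -- Outside the unit ball 1 + ‖x‖ ≤ 2‖x‖, whence the factor 2^α; integrability needs α to exceed
  -- the dimension 2.
  have hint : Integrable (fun x : Plane => 2 ^ α * (1 + ‖x‖) ^ (-α)) volume :=
    (integrable_one_add_norm (by simpa using hα)).const_mul _
  refine lt_of_le_of_lt (lintegral_mono fun x => ?_) hint.lintegral_lt_top
  by_cases hx : 1 < ‖x‖
  · rw [Set.indicator_of_mem (by exact hx)]
    refine ENNReal.ofReal_le_ofReal ?_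
    have hx0 : 0 < ‖x‖ := by linarith
    rw [Real.rpow_neg hx0.le, Real.rpow_neg (by positivity), ← div_eq_mul_inv, ← one_div,
      div_le_div_iff₀ (by positivity) (by positivity), one_mul,
      ← Real.mul_rpow (by norm_num) hx0.le]
    exact Real.rpow_le_rpow (by positivity) (by linarith) (by linarith)
  · rw [Set.indicator_of_notMem (by exact hx)]
    exact zero_le

namespace IsD2DNetwork

lemma ae_gain_pos (hnet : IsD2DNetwork P c N z h g) : ∀ᵐ ω ∂P, ∀ i, 0 < g i ω :=
  ae_all_iff.2 fun i => ae_pos_of_law_exp (hnet.measurable_g i) (hnet.law_g i)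

lemma ae_interferenceTerm_nonneg (hnet : IsD2DNetwork P c N z h g) (hρ : 0 < ρ) :
    ∀ᵐ ω ∂P, ∀ i, 0 ≤ interferenceTerm ρ α zo N z g i ω := by
  filter_upwards [hnet.ae_gain_pos] with ω hω i
  have := hω i
  unfold interferenceTerm
  split_ifs <;> positivity

lemma ae_interference_nonneg (hnet : IsD2DNetwork P c N z h g) (hρ : 0 < ρ) :
    ∀ᵐ ω ∂P, 0 ≤ interference ρ α zo N z g ω := by
  filter_upwards [hnet.ae_interferenceTerm_nonneg hρ] with ω hω
  exact tsum_nonneg hω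

/-- The sum has finite expectation: each gain has mean 1 and is independent of the points, so it
drops out, and Campbell's formula leaves the integral of the path loss. -/
lemma ae_summable_far [IsProbabilityMeasure P] (hnet : IsD2DNetwork P c N z h g) (hα : 2 < α) :
    ∀ᵐ ω ∂P, ∑' i : ℕ, {ω | (i : ℕ∞) < N ω}.indicator (fun ω =>
      {x : Plane | 1 < ‖x‖}.indicator (fun x => ENNReal.ofReal (‖x‖ ^ (-α))) (z i ω)) ω *
        ENNReal.ofReal (g i ω) < ⊤ := by
  set f : Plane → ENNReal := {x : Plane | 1 < ‖x‖}.indicator fun x => ENNReal.ofReal (‖x‖ ^ (-α))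
    with hf_def
  have hf : Measurable f :=
    Measurable.indicator (by fun_prop) (measurableSet_lt measurable_const measurable_norm)
  have hφ : ∀ i : ℕ, Measurable fun y : ℕ∞ × (ℕ → Plane) =>
      {y : ℕ∞ × (ℕ → Plane) | (i : ℕ∞) < y.1}.indicator (fun y => f (y.2 i)) y := fun i =>
    (hf.comp ((measurable_pi_apply i).comp measurable_snd)).indicator
      (measurable_fst (MeasurableSet.of_discrete (s := Set.Ioi (i : ℕ∞))))
  have hψ : ∀ i : ℕ, Measurable fun y : ℕ → ℝ => ENNReal.ofReal (y i) := fun i => by fun_prop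
  have hΘ : Measurable fun ω => (N ω, fun i => z i ω) :=
    hnet.poisson.measurable_total.prodMk (measurable_pi_lambda _ hnet.poisson.measurable_point)
  have hmeas : ∀ i : ℕ, Measurable fun ω =>
      {ω | (i : ℕ∞) < N ω}.indicator (fun ω => f (z i ω)) ω := fun i => (hφ i).comp hΘ
  have hmg : ∀ i : ℕ, Measurable fun ω => ENNReal.ofReal (g i ω) :=
    fun i => (hnet.measurable_g i).ennreal_ofReal
  refine ae_lt_top (Measurable.tsum fun i => (hmeas i).mul (hmg i)) (ne_of_lt ?_)
  refine (lintegral_tsum fun i => ((hmeas i).mul (hmg i)).aemeasurable).trans_lt ?_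
  simp only [Pi.mul_apply]
  have hfac : ∀ i : ℕ, ∫⁻ ω, {ω | (i : ℕ∞) < N ω}.indicator (fun ω => f (z i ω)) ω *
      ENNReal.ofReal (g i ω) ∂P =
      ∫⁻ ω, {ω | (i : ℕ∞) < N ω}.indicator (fun ω => f (z i ω)) ω ∂P := by
    intro i
    have hind := hnet.indep_points_g.comp (hφ i) (hψ i)
    have := lintegral_mul_eq_lintegral_mul_lintegral_of_indepFun (hmeas i) (hmg i) hind
    rw [lintegral_ofReal_of_law_exp (hnet.measurable_g i) (hnet.law_g i), mul_one] at this
    exact this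
  simp_rw [hfac]
  -- The instance is for finite scalars, so `ENNReal.ofReal c` is read as the coercion of
  -- `c.toNNReal`.
  have : SigmaFinite (ENNReal.ofReal c • (volume : Measure Plane)) :=
    inferInstanceAs (SigmaFinite (c.toNNReal • (volume : Measure Plane)))
  rw [hnet.poisson.tsum_lintegral_point hf]
  exact lintegral_pathLoss_lt_top hα

/-- The path loss is singular at the origin and has no finite mean there, but only finitely many
points fall in the unit ball; all other terms are dominated by the far sum. -/
theorem ae_summable_interferenceTerm [IsProbabilityMeasure P] (hnet : IsD2DNetwork P c N z h g)
    (hρ : 0 < ρ) (hα : 2 < α) :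
    ∀ᵐ ω ∂P, Summable fun i => interferenceTerm ρ α zo N z g i ω := by
  have hball : (ENNReal.ofReal c • (volume : Measure Plane)) (Metric.closedBall 0 1) < ⊤ :=
    ENNReal.mul_lt_top ENNReal.ofReal_lt_top measure_closedBall_lt_top
  filter_upwards [hnet.ae_gain_pos, hnet.ae_summable_far hα,
    hnet.poisson.ae_finite_points Metric.isClosed_closedBall.measurableSet hball]
    with ω hg hfar hfin
  have hfar' := (ENNReal.summable_toReal hfar.ne).mul_left ρ
  refine Summable.of_norm_bounded_eventually hfar' ?_
  refine (hfin.eventually_cofinite_notMem).mono fun i hi => ?_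
  have hgi := hg i
  unfold interferenceTerm
  split_ifs with hN
  · have hz : 1 < ‖z i ω‖ := by
      by_contra hle
      exact hi ⟨hN.1, by simpa using hle⟩
    have hpow : 0 ≤ ‖z i ω‖ ^ (-α) := by positivity
    rw [Set.indicator_of_mem (by exact hN.1), Set.indicator_of_mem (by exact hz),
      ENNReal.toReal_mul, ENNReal.toReal_ofReal hpow, ENNReal.toReal_ofReal hgi.le,
      Real.norm_of_nonneg (by positivity)]
    exact le_of_eq (by ring)
  · rw [norm_zero]
    positivity

end IsD2DNetwork

end Network

/-! ### The first point in a set. -/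

section FirstHit

variable {Ω E : Type*}

/-- The event that the first point of the point process in `B` has index `i`. -/
def firstHit (N : Ω → ℕ∞) (z : ℕ → Ω → E) (B : Set E) (i : ℕ) : Set Ω :=
  {ω | ((i : ℕ∞) < N ω ∧ z i ω ∈ B) ∧ ∀ j < i, ¬((j : ℕ∞) < N ω ∧ z j ω ∈ B)}

lemma measurableSet_firstHit [MeasurableSpace Ω] [MeasurableSpace E] {N : Ω → ℕ∞}
    {z : ℕ → Ω → E} (hN : Measurable N) (hz : ∀ i, Measurable (z i)) {B : Set E}
    (hB : MeasurableSet B) (i : ℕ) : MeasurableSet (firstHit N z B i) := by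
  have hi : firstHit N z B i = {ω | (i : ℕ∞) < N ω ∧ z i ω ∈ B} ∩
      ⋂ j : ℕ, ⋂ _ : j < i, {ω | (j : ℕ∞) < N ω ∧ z j ω ∈ B}ᶜ := by
    ext ω
    simp [firstHit]
  rw [hi]
  exact (measurableSet_point_mem hN hz hB i).inter <| MeasurableSet.iInter fun j =>
    MeasurableSet.iInter fun _ => (measurableSet_point_mem hN hz hB j).compl

lemma pairwise_disjoint_firstHit (N : Ω → ℕ∞) (z : ℕ → Ω → E) (B : Set E) :
    Pairwise (fun i j => Disjoint (firstHit N z B i) (firstHit N z B j)) := by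
  intro i j hij
  refine Set.disjoint_left.2 fun ω hi hj => ?_
  rcases hij.lt_or_gt with hlt | hlt
  · exact hj.2 i hlt hi.1
  · exact hi.2 j hlt hj.1

lemma exists_mem_firstHit {N : Ω → ℕ∞} {z : ℕ → Ω → E} {B : Set E} {ω : Ω}
    (h : ∃ i : ℕ, (i : ℕ∞) < N ω ∧ z i ω ∈ B) : ∃ i, ω ∈ firstHit N z B i := by
  classical
  exact ⟨Nat.find h, Nat.find_spec h, fun _ hj => Nat.find_min h hj⟩

end FirstHit

/-! ### Decay of the Laplace transform of the interference. -/

section Network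

variable {Ω : Type*} [MeasurableSpace Ω] {P : Measure Ω} {c ρ α : ℝ} {zo : Plane}
  {N : Ω → ℕ∞} {z : ℕ → Ω → Plane} {h : Ω → ℝ} {g : ℕ → Ω → ℝ}

/-- By independence and Fubini, freeze Y and use the exponential tail of X. -/
lemma measure_lt_of_indepFun_of_law_exp [IsProbabilityMeasure P] {X Y : Ω → ℝ}
    (hX : Measurable X) (hY : Measurable Y) (hlaw : P.map X = expMeasure 1)
    (hXY : IndepFun X Y P) (hY0 : ∀ᵐ ω ∂P, 0 ≤ Y ω) :
    P {ω | Y ω < X ω} = ∫⁻ ω, ENNReal.ofReal (Real.exp (-Y ω)) ∂P := by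
  have hprob := isProbabilityMeasure_expMeasure (r := 1) one_pos
  have hpY : IsProbabilityMeasure (P.map Y) := Measure.isProbabilityMeasure_map hY.aemeasurable
  have hs : MeasurableSet {q : ℝ × ℝ | q.2 < q.1} := measurableSet_lt measurable_snd measurable_fst
  have hmap := (indepFun_iff_map_prod_eq_prod_map_map hX.aemeasurable hY.aemeasurable).1 hXY
  have h1 : P {ω | Y ω < X ω} = P.map (fun ω => (X ω, Y ω)) {q : ℝ × ℝ | q.2 < q.1} := by
    rw [Measure.map_apply (hX.prodMk hY) hs]
    rfl
  rw [h1, hmap, hlaw, Measure.prod_apply_symm hs,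
    lintegral_map (measurable_measure_prodMk_right hs) hY]
  refine lintegral_congr_ae ?_
  filter_upwards [hY0] with ω hω
  exact expMeasure_one_Ioi hω

namespace IsD2DNetwork

/-- The first summand is the probability of finding no point in the ball. Otherwise the first point
found has gain independent of its index, and its term alone bounds the interference from below; the
first-hit events are disjoint, so their probabilities sum to at most 1. -/
lemma lintegral_exp_neg_interference_le [IsProbabilityMeasure P]
    (hnet : IsD2DNetwork P c N z h g) (hc : 0 ≤ c) (hρ : 0 < ρ) (hα : 2 < α) {s r : ℝ}
    (hs : 0 < s) (hr : 0 < r) :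
    ∫⁻ ω, ENNReal.ofReal (Real.exp (-s * interference ρ α zo N z g ω)) ∂P ≤
      ENNReal.ofReal (Real.exp (-(c * Real.pi * r ^ 2))) +
        ENNReal.ofReal (1 / (s * (ρ * r ^ (-α)))) := by
  -- Two null points are removed: `zo`, whose term is set to 0, and the origin, where the real power
  -- `0 ^ (-α)` takes the default value 0 instead of being large.
  set B : Set Plane := Metric.closedBall 0 r \ {0, zo} with hB_def
  have hnull : (volume : Measure Plane) {0, zo} = 0 := (Set.toFinite {0, zo}).measure_zero _
  have hB : MeasurableSet B :=
    Metric.isClosed_closedBall.measurableSet.diff (Set.toFinite {0, zo}).measurableSet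
  have hνB : (ENNReal.ofReal c • (volume : Measure Plane)) B =
      ENNReal.ofReal (c * Real.pi * r ^ 2) := by
    rw [Measure.smul_apply, hB_def, measure_sdiff_null hnull,
      EuclideanSpace.volume_closedBall_fin_two, smul_eq_mul]
    rw [ENNReal.ofReal_mul (by positivity), ENNReal.ofReal_mul hc, ENNReal.ofReal_pow hr.le,
      mul_assoc, mul_comm (ENNReal.ofReal Real.pi)]
  have hzm := hnet.poisson.measurable_point
  have hNm := hnet.poisson.measurable_total
  set κ := s * (ρ * r ^ (-α)) with hκ_def
  have hκ : 0 < κ := by positivity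
  have hA := measurableSet_firstHit hNm hzm hB
  have hE : MeasurableSet {ω | ∀ i : ℕ, (i : ℕ∞) < N ω → z i ω ∉ B} := by
    have : {ω | ∀ i : ℕ, (i : ℕ∞) < N ω → z i ω ∉ B} =
        ⋂ i : ℕ, {ω | (i : ℕ∞) < N ω ∧ z i ω ∈ B}ᶜ := by
      ext ω
      simp
    rw [this]
    exact MeasurableSet.iInter fun i => (measurableSet_point_mem hNm hzm hB i).compl
  have hψ : ∀ i : ℕ, Measurable fun y : ℕ → ℝ => ENNReal.ofReal (Real.exp (-κ * y i)) :=
    fun i => by fun_prop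
  have hmg : ∀ i : ℕ, Measurable fun ω => ENNReal.ofReal (Real.exp (-κ * g i ω)) :=
    fun i => (hψ i).comp (measurable_pi_lambda _ hnet.measurable_g)
  -- The first-hit event is expressed on the space of values of `(N, z)`, so that independence of
  -- points and gains applies to it.
  have hφ : ∀ i : ℕ, Measurable ((firstHit (fun y : ℕ∞ × (ℕ → Plane) => y.1)
      (fun j y => y.2 j) B i).indicator fun _ => (1 : ENNReal)) := fun i =>
    measurable_const.indicator (measurableSet_firstHit measurable_fst
      (fun j => (measurable_pi_apply j).comp measurable_snd) hB i)
  have hmA : ∀ i : ℕ, Measurable ((firstHit N z B i).indicator fun _ => (1 : ENNReal)) :=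
    fun i => measurable_const.indicator (hA i)
  have hterm : ∀ i, ∫⁻ ω, (firstHit N z B i).indicator (fun _ => (1 : ENNReal)) ω *
      ENNReal.ofReal (Real.exp (-κ * g i ω)) ∂P ≤
      P (firstHit N z B i) * ENNReal.ofReal (1 / κ) := by
    intro i
    have hind := hnet.indep_points_g.comp (hφ i) (hψ i)
    have hmul := lintegral_mul_eq_lintegral_mul_lintegral_of_indepFun (hmA i) (hmg i) hind
    simp only [Pi.mul_apply] at hmul
    rw [hmul, lintegral_indicator_const (hA i), one_mul]
    gcongr
    exact lintegral_exp_neg_mul_le_of_law_exp (hnet.measurable_g i) (hnet.law_g i) hκ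
  have hpoint : ∀ᵐ ω ∂P, ENNReal.ofReal (Real.exp (-s * interference ρ α zo N z g ω)) ≤
      {ω | ∀ i : ℕ, (i : ℕ∞) < N ω → z i ω ∉ B}.indicator (fun _ => (1 : ENNReal)) ω +
      ∑' i, (firstHit N z B i).indicator (fun _ => (1 : ENNReal)) ω *
        ENNReal.ofReal (Real.exp (-κ * g i ω)) := by
    filter_upwards [hnet.ae_interferenceTerm_nonneg hρ, hnet.ae_gain_pos,
      hnet.ae_summable_interferenceTerm hρ hα] with ω hnn hg hsum
    by_cases hω : ∀ i : ℕ, (i : ℕ∞) < N ω → z i ω ∉ B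
    · rw [Set.indicator_of_mem (by exact hω)]
      refine le_add_of_le_of_nonneg ?_ zero_le
      have : 0 ≤ s * interference ρ α zo N z g ω := mul_nonneg hs.le (tsum_nonneg hnn)
      simpa using this
    · push Not at hω
      obtain ⟨i, hi⟩ := exists_mem_firstHit hω
      refine le_add_of_nonneg_of_le zero_le (le_trans ?_ (ENNReal.le_tsum i))
      rw [Set.indicator_of_mem hi, one_mul]
      refine ENNReal.ofReal_le_ofReal (Real.exp_le_exp.2 ?_)
      obtain ⟨hzr, hz0⟩ := hi.1.2
      simp only [Set.mem_insert_iff, Set.mem_singleton_iff, not_or] at hz0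
      have hle : interferenceTerm ρ α zo N z g i ω ≤ interference ρ α zo N z g ω :=
        hsum.le_tsum i fun j _ => hnn j
      have hpow : r ^ (-α) ≤ ‖z i ω‖ ^ (-α) :=
        Real.rpow_le_rpow_of_nonpos (norm_pos_iff.2 hz0.1) (by simpa using hzr) (by linarith)
      have hval : interferenceTerm ρ α zo N z g i ω = ρ * g i ω * ‖z i ω‖ ^ (-α) :=
        if_pos ⟨hi.1.1, hz0.2⟩
      have hgi := hg i
      have h2 : ρ * g i ω * r ^ (-α) ≤ ρ * g i ω * ‖z i ω‖ ^ (-α) := by gcongr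
      have h3 : s * (ρ * g i ω * r ^ (-α)) ≤ s * interference ρ α zo N z g ω := by
        gcongr
        linarith
      rw [hκ_def]
      linarith
  calc ∫⁻ ω, ENNReal.ofReal (Real.exp (-s * interference ρ α zo N z g ω)) ∂P
      ≤ ∫⁻ ω, ({ω | ∀ i : ℕ, (i : ℕ∞) < N ω → z i ω ∉ B}.indicator (fun _ => (1 : ENNReal)) ω +
          ∑' i, (firstHit N z B i).indicator (fun _ => (1 : ENNReal)) ω *
            ENNReal.ofReal (Real.exp (-κ * g i ω))) ∂P := lintegral_mono_ae hpoint
    _ = P {ω | ∀ i : ℕ, (i : ℕ∞) < N ω → z i ω ∉ B} +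
          ∑' i, ∫⁻ ω, (firstHit N z B i).indicator (fun _ => (1 : ENNReal)) ω *
            ENNReal.ofReal (Real.exp (-κ * g i ω)) ∂P := by
        rw [lintegral_add_left (measurable_const.indicator hE), lintegral_indicator_const hE,
          one_mul]
        exact congrArg _ (lintegral_tsum fun i => ((hmA i).mul (hmg i)).aemeasurable)
    _ ≤ P {ω | ∀ i : ℕ, (i : ℕ∞) < N ω → z i ω ∉ B} +
          ∑' i, P (firstHit N z B i) * ENNReal.ofReal (1 / κ) := by
        gcongr with i
        exact hterm i
    _ ≤ _ := by
        rw [hnet.poisson.measure_no_point_mem hB (by rw [hνB]; exact ENNReal.ofReal_lt_top),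
          hνB, ENNReal.toReal_ofReal (by positivity), ENNReal.tsum_mul_right]
        gcongr
        refine mul_le_of_le_one_left zero_le ?_
        refine (tsum_measure_le_measure_univ (fun i => (hA i).nullMeasurableSet)
          fun i j hij => (pairwise_disjoint_firstHit N z B hij).aedisjoint).trans ?_
        exact prob_le_one

end IsD2DNetwork

end Network

/-! ### Laplace transforms of nonnegative random variables. -/

section Laplace

variable {Ω : Type*} [MeasurableSpace Ω] {P : Measure Ω} {X : Ω → ℝ} {s : ℝ}

lemma laplaceTransform_nonneg (P : Measure Ω) (X : Ω → ℝ) (s : ℝ) : 0 ≤ laplaceTransform P X s :=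
  integral_nonneg fun _ => (Real.exp_pos _).le

lemma integrable_exp_neg_mul [IsProbabilityMeasure P] (hX : Measurable X)
    (hX0 : ∀ᵐ ω ∂P, 0 ≤ X ω) (hs : 0 ≤ s) : Integrable (fun ω => Real.exp (-s * X ω)) P := by
  refine Integrable.of_bound (by fun_prop) 1 ?_
  filter_upwards [hX0] with ω hω
  rw [Real.norm_of_nonneg (Real.exp_pos _).le, Real.exp_le_one_iff]
  nlinarith

lemma ofReal_laplaceTransform [IsProbabilityMeasure P] (hX : Measurable X)
    (hX0 : ∀ᵐ ω ∂P, 0 ≤ X ω) (hs : 0 ≤ s) :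
    ENNReal.ofReal (laplaceTransform P X s) = ∫⁻ ω, ENNReal.ofReal (Real.exp (-s * X ω)) ∂P :=
  ofReal_integral_eq_lintegral_ofReal (integrable_exp_neg_mul hX hX0 hs)
    (Filter.Eventually.of_forall fun _ => (Real.exp_pos _).le)

lemma laplaceTransform_le_one [IsProbabilityMeasure P] (hX : Measurable X)
    (hX0 : ∀ᵐ ω ∂P, 0 ≤ X ω) (hs : 0 ≤ s) : laplaceTransform P X s ≤ 1 := by
  have h : laplaceTransform P X s ≤ ∫ _, (1 : ℝ) ∂P := by
    refine integral_mono_ae (integrable_exp_neg_mul hX hX0 hs) (integrable_const _) ?_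
    filter_upwards [hX0] with ω hω
    rw [Real.exp_le_one_iff]
    nlinarith
  simpa using h

lemma measurable_laplaceTransform [SFinite P] (hX : Measurable X) :
    Measurable (laplaceTransform P X) := by
  have h : Measurable (Function.uncurry fun (s : ℝ) (ω : Ω) => Real.exp (-s * X ω)) := by
    unfold Function.uncurry
    fun_prop
  exact h.stronglyMeasurable.integral_prod_right.measurable

lemma measure_nonpos_le_laplaceTransform [IsProbabilityMeasure P] (hX : Measurable X)
    (hX0 : ∀ᵐ ω ∂P, 0 ≤ X ω) (hs : 0 ≤ s) :
    P {ω | X ω ≤ 0} ≤ ENNReal.ofReal (laplaceTransform P X s) := by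
  rw [ofReal_laplaceTransform hX hX0 hs,
    ← lintegral_indicator_one (measurableSet_le hX measurable_const)]
  refine lintegral_mono fun ω => ?_
  by_cases hω : X ω ≤ 0
  · rw [Set.indicator_of_mem (by exact hω)]
    have : 1 ≤ Real.exp (-s * X ω) := Real.one_le_exp (by nlinarith)
    simpa using this
  · rw [Set.indicator_of_notMem (by exact hω)]
    exact zero_le

end Laplace

lemma Real.exp_neg_le_one_div {x : ℝ} (hx : 0 < x) : Real.exp (-x) ≤ 1 / x := by
  rw [Real.exp_neg, ← one_div]
  exact one_div_le_one_div_of_le hx (by linarith [Real.add_one_le_exp x])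

lemma D2DMode.indFD_nonneg (δ : D2DMode) : 0 ≤ δ.indFD := by
  cases δ <;> simp [D2DMode.indFD]

/-! ### Positivity of the denominator, tail of the SINR, and the layer-cake identity. -/

section Network

variable {Ω : Type*} [MeasurableSpace Ω] {P : Measure Ω} {c ρ α σ2 β R : ℝ} {zo : Plane}
  {N : Ω → ℕ∞} {z : ℕ → Ω → Plane} {h : Ω → ℝ} {g : ℕ → Ω → ℝ} {δ : D2DMode}

namespace IsD2DNetwork

lemma measurable_interference (hnet : IsD2DNetwork P c N z h g) :
    Measurable (interference ρ α zo N z g) :=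
  _root_.measurable_interference hnet.poisson.measurable_total hnet.poisson.measurable_point
    hnet.measurable_g

lemma laplaceTransform_interference_le [IsProbabilityMeasure P]
    (hnet : IsD2DNetwork P c N z h g) (hc : 0 < c) (hρ : 0 < ρ) (hα : 2 < α) {s r : ℝ}
    (hs : 0 < s) (hr : 0 < r) :
    laplaceTransform P (interference ρ α zo N z g) s ≤
      1 / (c * Real.pi * r ^ 2) + 1 / (s * (ρ * r ^ (-α))) := by
  have h1 := hnet.lintegral_exp_neg_interference_le (zo := zo) hc.le hρ hα hs hr
  rw [← ofReal_laplaceTransform hnet.measurable_interference (hnet.ae_interference_nonneg hρ) hs.le,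
    ← ENNReal.ofReal_add (Real.exp_pos _).le (by positivity),
    ENNReal.ofReal_le_ofReal_iff (by positivity)] at h1
  have h2 : Real.exp (-(c * Real.pi * r ^ 2)) ≤ 1 / (c * Real.pi * r ^ 2) :=
    Real.exp_neg_le_one_div (by positivity)
  linarith

lemma ae_interference_pos [IsProbabilityMeasure P] (hnet : IsD2DNetwork P c N z h g)
    (hc : 0 < c) (hρ : 0 < ρ) (hα : 2 < α) : ∀ᵐ ω ∂P, 0 < interference ρ α zo N z g ω := by
  have hbound : ∀ r : ℝ, 0 < r → P {ω | interference ρ α zo N z g ω ≤ 0} ≤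
      ENNReal.ofReal ((1 / (c * Real.pi) + 1 / ρ) * (r ^ 2)⁻¹) := by
    intro r hr
    -- This choice of s reduces the second term of the bound to 1/(ρ r²), so both terms vanish as r
    -- grows.
    have hs : 0 < r ^ α * r ^ 2 := by positivity
    refine (measure_nonpos_le_laplaceTransform hnet.measurable_interference
      (hnet.ae_interference_nonneg hρ) hs.le).trans (ENNReal.ofReal_le_ofReal ?_)
    refine (hnet.laplaceTransform_interference_le hc hρ hα hs hr).trans (le_of_eq ?_)
    rw [Real.rpow_neg hr.le]
    field_simp
  have hlim : Filter.Tendsto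
      (fun r : ℝ => ENNReal.ofReal ((1 / (c * Real.pi) + 1 / ρ) * (r ^ 2)⁻¹))
      Filter.atTop (nhds 0) := by
    rw [← ENNReal.ofReal_zero]
    refine ENNReal.tendsto_ofReal ?_
    rw [← mul_zero (1 / (c * Real.pi) + 1 / ρ)]
    exact ((Filter.tendsto_pow_atTop two_ne_zero).inv_tendsto_atTop).const_mul _
  have h0 : P {ω | interference ρ α zo N z g ω ≤ 0} = 0 :=
    le_antisymm (ge_of_tendsto hlim ((Filter.eventually_gt_atTop 0).mono hbound)) zero_le
  rw [ae_iff]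
  simpa using h0

theorem ae_sinrDenom_pos [IsProbabilityMeasure P] (hnet : IsD2DNetwork P c N z h g)
    (hρ : 0 < ρ) (hα : 2 < α) (hn : 0 ≤ σ2 + δ.indFD * (β * ρ))
    (hnd : 0 < σ2 + δ.indFD * (β * ρ) ∨ 0 < c) :
    ∀ᵐ ω ∂P, 0 < sinrDenom δ σ2 β ρ α zo N z g ω := by
  rcases hnd with hpos | hc
  · filter_upwards [hnet.ae_interference_nonneg hρ] with ω hω
    unfold sinrDenom
    linarith
  · filter_upwards [hnet.ae_interference_pos hc hρ hα] with ω hω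
    unfold sinrDenom
    linarith

/-- The interference is a measurable function of points and gains: it is the same definition
evaluated on the space of their values. -/
lemma indepFun_interference (hnet : IsD2DNetwork P c N z h g) :
    IndepFun h (interference ρ α zo N z g) P := by
  have hF : Measurable (interference ρ α zo (fun x : (ℕ∞ × (ℕ → Plane)) × (ℕ → ℝ) => x.1.1)
      (fun i x => x.1.2 i) (fun i x => x.2 i)) :=
    _root_.measurable_interference (measurable_fst.comp measurable_fst)
      (fun i => (measurable_pi_apply i).comp (measurable_snd.comp measurable_fst))
      (fun i => (measurable_pi_apply i).comp measurable_snd)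
  exact hnet.indep_h.comp measurable_id hF

/-- Solving for the fading gain turns the event into an exponential tail at an independent level.
The factor 1/(1 + t) is the derivative of log(1 + t) that the layer-cake formula supplies. -/
lemma measure_lt_sinr [IsProbabilityMeasure P] (hnet : IsD2DNetwork P c N z h g) (hρ : 0 < ρ)
    (hR : 0 < R) (hzo : ‖zo‖ = R) (hn : 0 ≤ σ2 + δ.indFD * (β * ρ))
    (hD : ∀ᵐ ω ∂P, 0 < sinrDenom δ σ2 β ρ α zo N z g ω) {t : ℝ} (ht : 0 < t) :
    P {ω | t < sinr δ σ2 β ρ α zo N z h g ω} * ENNReal.ofReal (1 / (1 + t)) =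
      ENNReal.ofReal (seIntegrand δ σ2 β ρ α R
        (laplaceTransform P (interference ρ α zo N z g)) t) := by
  set I := interference ρ α zo N z g with hI_def
  set n := σ2 + δ.indFD * (β * ρ) with hn_def
  have hIm : Measurable I := hnet.measurable_interference
  have hI0 : ∀ᵐ ω ∂P, 0 ≤ I ω := hnet.ae_interference_nonneg hρ
  set k := t * R ^ α / ρ with hk_def
  have hk : 0 < k := by positivity
  have hset : P {ω | t < sinr δ σ2 β ρ α zo N z h g ω} = P {ω | k * (n + I ω) < h ω} := by
    refine measure_congr ?_
    filter_upwards [hD] with ω hω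
    refine propext ?_
    change t < sinr δ σ2 β ρ α zo N z h g ω ↔ k * (n + I ω) < h ω
    have hDω : sinrDenom δ σ2 β ρ α zo N z g ω = n + I ω := by
      unfold sinrDenom
      ring
    rw [sinr, lt_div_iff₀ hω, hDω, hzo, Real.rpow_neg hR.le, hk_def, ← div_eq_mul_inv,
      lt_div_iff₀ (by positivity), div_mul_eq_mul_div, div_lt_iff₀ hρ]
    constructor <;> intro h1 <;> linarith
  have hmeas : Measurable fun x : ℝ => k * (n + x) := by fun_prop
  have htail : P {ω | k * (n + I ω) < h ω} =
      ∫⁻ ω, ENNReal.ofReal (Real.exp (-(k * (n + I ω)))) ∂P := by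
    refine measure_lt_of_indepFun_of_law_exp hnet.measurable_h (hmeas.comp hIm) hnet.law_h
      (hnet.indepFun_interference.comp measurable_id hmeas) ?_
    filter_upwards [hI0] with ω hω
    positivity
  have hsplit : ∀ ω, ENNReal.ofReal (Real.exp (-(k * (n + I ω)))) =
      ENNReal.ofReal (Real.exp (-(k * n))) * ENNReal.ofReal (Real.exp (-k * I ω)) := by
    intro ω
    rw [← ENNReal.ofReal_mul (Real.exp_pos _).le, ← Real.exp_add]
    congr 2
    ring
  simp_rw [hset, htail, hsplit]
  rw [lintegral_const_mul _ (by fun_prop), ← ofReal_laplaceTransform hIm hI0 hk.le,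
    ← ENNReal.ofReal_mul (Real.exp_pos _).le,
    ← ENNReal.ofReal_mul (mul_nonneg (Real.exp_pos _).le (laplaceTransform_nonneg _ _ _))]
  congr 1
  have hexp : -(n * R ^ α / ρ * t) = -(k * n) := by
    rw [hk_def]
    ring
  unfold seIntegrand
  rw [← hn_def, ← hk_def, neg_mul, neg_div, neg_mul, hexp]
  ring

lemma measurable_sinr (hnet : IsD2DNetwork P c N z h g) :
    Measurable (sinr δ σ2 β ρ α zo N z h g) := by
  have hI : Measurable (interference ρ α zo N z g) := hnet.measurable_interference
  have hh := hnet.measurable_h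
  unfold sinr sinrDenom
  fun_prop

lemma ae_sinr_nonneg (hnet : IsD2DNetwork P c N z h g) (hρ : 0 < ρ)
    (hD : ∀ᵐ ω ∂P, 0 < sinrDenom δ σ2 β ρ α zo N z g ω) :
    ∀ᵐ ω ∂P, 0 ≤ sinr δ σ2 β ρ α zo N z h g ω := by
  filter_upwards [hD, ae_pos_of_law_exp hnet.measurable_h hnet.law_h] with ω hω hh
  unfold sinr
  positivity

theorem lintegral_log_one_add_sinr [IsProbabilityMeasure P] (hnet : IsD2DNetwork P c N z h g)
    (hρ : 0 < ρ) (hR : 0 < R) (hzo : ‖zo‖ = R) (hn : 0 ≤ σ2 + δ.indFD * (β * ρ))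
    (hD : ∀ᵐ ω ∂P, 0 < sinrDenom δ σ2 β ρ α zo N z g ω) :
    ∫⁻ ω, ENNReal.ofReal (Real.log (1 + sinr δ σ2 β ρ α zo N z h g ω)) ∂P =
      ∫⁻ t in Set.Ioi (0 : ℝ), ENNReal.ofReal (seIntegrand δ σ2 β ρ α R
        (laplaceTransform P (interference ρ α zo N z g)) t) := by
  have hS0 := hnet.ae_sinr_nonneg hρ hD
  have hint : ∀ x : ℝ, 0 ≤ x → ∫ t in (0 : ℝ)..x, 1 / (1 + t) = Real.log (1 + x) := by
    intro x hx
    have h1 := intervalIntegral.integral_comp_add_left (a := 0) (b := x) (fun u : ℝ => 1 / u) 1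
    rw [h1, integral_one_div_of_pos (by norm_num) (by linarith)]
    simp
  have hcont : ∀ t > (0 : ℝ), IntervalIntegrable (fun t : ℝ => 1 / (1 + t)) volume 0 t := by
    intro t ht
    refine ContinuousOn.intervalIntegrable ?_
    refine continuousOn_const.div (by fun_prop) fun u hu => ?_
    rw [Set.uIcc_of_le ht.le] at hu
    have := hu.1
    positivity
  have hlayer := lintegral_comp_eq_lintegral_meas_lt_mul P hS0
    hnet.measurable_sinr.aemeasurable hcont
    ((ae_restrict_mem measurableSet_Ioi).mono fun t (ht : 0 < t) => by positivity)
  rw [← setLIntegral_congr_fun measurableSet_Ioi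
    fun t ht => hnet.measure_lt_sinr hρ hR hzo hn hD ht, ← hlayer]
  refine lintegral_congr_ae ?_
  filter_upwards [hS0] with ω hω
  rw [hint _ hω]

end IsD2DNetwork

/-! ### Integrability of the spectral efficiency integrand. -/

section Integrand

lemma seIntegrand_nonneg {L : ℝ → ℝ} (hL : ∀ s, 0 ≤ L s) {t : ℝ} (ht : 0 ≤ t) :
    0 ≤ seIntegrand δ σ2 β ρ α R L t :=
  mul_nonneg (by positivity) (hL _)

lemma measurable_seIntegrand {L : ℝ → ℝ} (hL : Measurable L) :
    Measurable (seIntegrand δ σ2 β ρ α R L) := by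
  unfold seIntegrand
  fun_prop

lemma seIntegrand_le {L : ℝ → ℝ} (hL : ∀ s, 0 ≤ L s) (hρ : 0 < ρ) (hR : 0 < R)
    (hn : 0 ≤ σ2 + δ.indFD * (β * ρ)) {t : ℝ} (ht : 0 < t) :
    seIntegrand δ σ2 β ρ α R L t ≤ 1 / (1 + t) * L (t * R ^ α / ρ) := by
  refine mul_le_mul_of_nonneg_right ?_ (hL _)
  refine div_le_div_of_nonneg_right ?_ (by linarith)
  rw [Real.exp_le_one_iff, neg_mul, neg_div, neg_mul, neg_nonpos]
  positivity

end Integrand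

namespace IsD2DNetwork

theorem integrableOn_seIntegrand [IsProbabilityMeasure P] (hnet : IsD2DNetwork P c N z h g)
    (hρ : 0 < ρ) (hR : 0 < R) (hα : 2 < α) (hn : 0 ≤ σ2 + δ.indFD * (β * ρ))
    (hnd : 0 < σ2 + δ.indFD * (β * ρ) ∨ 0 < c) :
    IntegrableOn (seIntegrand δ σ2 β ρ α R (laplaceTransform P (interference ρ α zo N z g)))
      (Set.Ioi 0) := by
  set L := laplaceTransform P (interference ρ α zo N z g) with hL_def
  have hL0 : ∀ s, 0 ≤ L s := laplaceTransform_nonneg _ _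
  have hL1 : ∀ s, 0 ≤ s → L s ≤ 1 := fun s hs =>
    laplaceTransform_le_one hnet.measurable_interference (hnet.ae_interference_nonneg hρ) hs
  have hm : Measurable (seIntegrand δ σ2 β ρ α R L) :=
    measurable_seIntegrand (measurable_laplaceTransform hnet.measurable_interference)
  rcases hnd with hpos | hc
  · have hb : -(σ2 + δ.indFD * (β * ρ)) * R ^ α / ρ < 0 := by
      rw [neg_mul, neg_div, neg_lt_zero]
      positivity
    refine Integrable.mono' (integrableOn_exp_mul_Ioi hb 0) hm.aestronglyMeasurable ?_
    filter_upwards [ae_restrict_mem measurableSet_Ioi] with t ht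
    have ht0 : 0 < t := ht
    rw [Real.norm_of_nonneg (seIntegrand_nonneg hL0 ht0.le)]
    exact (mul_le_mul (div_le_self (Real.exp_pos _).le (by linarith))
      (hL1 _ (by positivity)) (hL0 _) (Real.exp_pos _).le).trans_eq (mul_one _)
  -- Without noise the exponential factor may be 1. The integrand is at most 1 on (0, 1], and on (1,
  -- ∞) it is bounded by a multiple of t^(-1 - 1/α).
  · rw [← Set.Ioc_union_Ioi_eq_Ioi (zero_le_one (α := ℝ))]
    refine IntegrableOn.union ?_ ?_
    · refine Measure.integrableOn_of_bounded (M := 1) (by simp) hm.aestronglyMeasurable ?_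
      filter_upwards [ae_restrict_mem measurableSet_Ioc] with t ht
      have ht0 : 0 < t := ht.1
      rw [Real.norm_of_nonneg (seIntegrand_nonneg hL0 ht0.le)]
      refine (seIntegrand_le hL0 hρ hR hn ht0).trans ?_
      refine mul_le_one₀ ?_ (hL0 _) (hL1 _ (by positivity))
      rw [div_le_one (by positivity)]
      linarith
    · have hα0 : 0 < α := by linarith
      have hexp : -1 - 1 / α < -1 := by
        have : 0 < 1 / α := by positivity
        linarith
      refine Integrable.mono' ((integrableOn_Ioi_rpow_of_lt hexp one_pos).const_mul
        (1 / (c * Real.pi) + (R ^ α)⁻¹)) hm.aestronglyMeasurable ?_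
      filter_upwards [ae_restrict_mem measurableSet_Ioi] with t ht
      have ht1 : 1 < t := ht
      have ht0 : 0 < t := by linarith
      rw [Real.norm_of_nonneg (seIntegrand_nonneg hL0 ht0.le)]
      refine (seIntegrand_le hL0 hρ hR hn ht0).trans ?_
      -- With r = t^(1/(2α)) the two terms decay like t^(-1/α) and t^(-1/2); since α > 2, the former
      -- rate is the slower and bounds both.
      have hLt := hnet.laplaceTransform_interference_le (zo := zo) hc hρ hα
        (s := t * R ^ α / ρ) (r := t ^ (1 / (2 * α))) (by positivity) (by positivity)
      have h1 : (t ^ (1 / (2 * α))) ^ 2 = t ^ (1 / α) := by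
        rw [← Real.rpow_natCast, ← Real.rpow_mul ht0.le]
        congr 1
        push_cast
        field_simp
      have h2 : t * (t ^ (1 / (2 * α))) ^ (-α) = t ^ (1 / 2 : ℝ) := by
        rw [← Real.rpow_mul ht0.le]
        nth_rewrite 1 [← Real.rpow_one t]
        rw [← Real.rpow_add ht0]
        congr 1
        field_simp
        ring
      have h3 : t * R ^ α / ρ * (ρ * (t ^ (1 / (2 * α))) ^ (-α)) = R ^ α * t ^ (1 / 2 : ℝ) := by
        rw [← h2]
        field_simp
      have h4 : t ^ (1 / α) ≤ t ^ (1 / 2 : ℝ) :=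
        Real.rpow_le_rpow_of_exponent_le ht1.le
          (one_div_le_one_div_of_le (by norm_num) hα.le)
      have hpow : 0 < t ^ (1 / α) := by positivity
      have h5 : L (t * R ^ α / ρ) ≤ (1 / (c * Real.pi) + (R ^ α)⁻¹) * (t ^ (1 / α))⁻¹ := by
        refine hLt.trans ?_
        rw [h1, h3]
        have h6 : 1 / (R ^ α * t ^ (1 / 2 : ℝ)) ≤ 1 / (R ^ α * t ^ (1 / α)) := by gcongr
        refine (add_le_add_right h6 _).trans (le_of_eq ?_)
        field_simp
      have h7 : 1 / (1 + t) ≤ t⁻¹ := by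
        rw [← one_div]
        exact one_div_le_one_div_of_le ht0 (by linarith)
      have h8 : t ^ (-1 - 1 / α) = t⁻¹ * (t ^ (1 / α))⁻¹ := by
        rw [Real.rpow_sub ht0, Real.rpow_neg_one, div_eq_mul_inv]
      rw [h8]
      calc 1 / (1 + t) * L (t * R ^ α / ρ)
          ≤ t⁻¹ * ((1 / (c * Real.pi) + (R ^ α)⁻¹) * (t ^ (1 / α))⁻¹) :=
            mul_le_mul h7 h5 (hL0 _) (by positivity)
        _ = _ := by ring

end IsD2DNetwork

end Network

/-! ### The spectral efficiency formula. -/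

theorem theorem2 {Ω : Type*} [MeasurableSpace Ω] (P : Measure Ω) [IsProbabilityMeasure P]
    (δ : D2DMode) (lam μ p α β σ2 ρ R : ℝ)
    (hlam : 0 < lam) (hμ : 0 ≤ μ) (hμ1 : μ ≤ 1) (hp : 0 ≤ p) (hp1 : p ≤ 1) (hα : 2 < α)
    (hβ : 0 ≤ β) (hβ1 : β ≤ 1) (hσ : 0 ≤ σ2) (hρ : 0 < ρ) (hR : 0 < R)
    -- the SINR is not a quotient by zero
    (hnd : 0 < σ2 + δ.indFD * (β * ρ) ∨ 0 < μ * p * lam)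
    (zo : Plane) (hzo : ‖zo‖ = R)
    (N : Ω → ℕ∞) (z : ℕ → Ω → Plane) (h : Ω → ℝ) (g : ℕ → Ω → ℝ)
    (hnet : IsD2DNetwork P (μ * p * lam) N z h g) :
    (∀ᵐ ω ∂P, Summable (fun i => interferenceTerm ρ α zo N z g i ω)) ∧
    (∀ᵐ ω ∂P, 0 < sinrDenom δ σ2 β ρ α zo N z g ω) ∧
    Integrable (fun ω => Real.logb 2 (1 + sinr δ σ2 β ρ α zo N z h g ω)) P ∧
    IntegrableOn
      (seIntegrand δ σ2 β ρ α R (laplaceTransform P (interference ρ α zo N z g)))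
      (Set.Ioi 0) ∧
    spectralEfficiency P δ σ2 β ρ α zo N z h g =
      δ.kappa / Real.log 2 *
        ∫ τ in Set.Ioi (0 : ℝ),
          seIntegrand δ σ2 β ρ α R (laplaceTransform P (interference ρ α zo N z g)) τ := by
  have hn : 0 ≤ σ2 + δ.indFD * (β * ρ) := by
    have := δ.indFD_nonneg
    positivity
  have hD : ∀ᵐ ω ∂P, 0 < sinrDenom δ σ2 β ρ α zo N z g ω := hnet.ae_sinrDenom_pos hρ hα hn hnd
  have hI := hnet.integrableOn_seIntegrand (zo := zo) hρ hR hα hn hnd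
  have hL0 := laplaceTransform_nonneg P (interference ρ α zo N z g)
  have hI0 : ∀ᵐ t ∂(volume.restrict (Set.Ioi (0 : ℝ))), 0 ≤ seIntegrand δ σ2 β ρ α R
      (laplaceTransform P (interference ρ α zo N z g)) t :=
    (ae_restrict_mem measurableSet_Ioi).mono fun t ht => seIntegrand_nonneg hL0 (le_of_lt ht)
  have hkey := hnet.lintegral_log_one_add_sinr hρ hR hzo hn hD
  have hlog0 : ∀ᵐ ω ∂P, 0 ≤ Real.log (1 + sinr δ σ2 β ρ α zo N z h g ω) :=
    (hnet.ae_sinr_nonneg hρ hD).mono fun ω hω => Real.log_nonneg (by linarith)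
  have hlogm : AEStronglyMeasurable
      (fun ω => Real.log (1 + sinr δ σ2 β ρ α zo N z h g ω)) P :=
    (Real.measurable_log.comp (hnet.measurable_sinr.const_add 1)).aestronglyMeasurable
  -- Finiteness passes from the integral over t to the expectation through the extended-valued
  -- identity.
  have hlogi : Integrable (fun ω => Real.log (1 + sinr δ σ2 β ρ α zo N z h g ω)) P := by
    refine (lintegral_ofReal_ne_top_iff_integrable hlogm hlog0).1 ?_
    rw [hkey]
    exact (lintegral_ofReal_ne_top_iff_integrable hI.aestronglyMeasurable hI0).2 hI
  refine ⟨hnet.ae_summable_interferenceTerm hρ hα, hD, hlogi.div_const _, hI, ?_⟩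
  unfold spectralEfficiency Real.logb
  rw [integral_div, integral_eq_lintegral_of_nonneg_ae hlog0 hlogm, hkey,
    ← integral_eq_lintegral_of_nonneg_ae hI0 hI.aestronglyMeasurable]
  ring
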